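/- Fix a set $\mathsf{Prop}$ of propositional variables with a numbering, i.e. an injection $\mathsf{Prop}\to\mathbb{N}$. Formulas of instantial game logic are given by $$\varphi ::= p\in\mathsf{Prop}\mid \neg\varphi\mid\varphi\wedge\varphi\mid[\mathtt{P}](\Psi;\varphi)\qquad(\mathtt{P}\in\{\mathtt{A},\mathtt{B}\}),$$ where $\Psi=\{\psi_1,\dots,\psi_n\}$ ($n\ge 0$) is a finite set of formulas, presented by a list $\psi_1,\dots,\psi_n$. Write $\overline{\mathtt{A}}=\mathtt{B}$, $\overline{\mathtt{B}}=\mathtt{A}$, $[\mathtt{P}]\varphi=[\mathtt{P}](\emptyset;\varphi)$, let $\vee,\to,\leftrightarrow$ be the usual abbreviations, $\bot=\chi\wedge\neg\chi$ and $\top=\neg\bot$ for an arbitrary formula $\chi$. The size $|\varphi|$ is the number of occurrences of variables, connectives and modalities in $\varphi$. The system $\mathbf{IGL}$ has as axioms all classical propositional tautologies (in the modal language) and all instances of - (Mon) $[\mathtt{P}](\psi_1,\dots,\psi_n;\varphi)\to[\mathtt{P}](\psi_1\vee\alpha_1,\dots,\psi_n\vee\alpha_n;\varphi\vee\beta)$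 - (Weak) $[\mathtt{P}](\Psi;\varphi)\to[\mathtt{P}](\Psi';\varphi)$ for $\Psi'\subseteq\Psi$ - (Un) $[\mathtt{P}](\psi_1,\dots,\psi_n;\varphi)\to[\mathtt{P}](\psi_1\wedge\varphi,\dots,\psi_n\wedge\varphi;\varphi)$ - (Lem) $[\mathtt{P}](\Psi;\varphi)\to[\mathtt{P}](\Psi\cup\{\gamma\};\varphi)\vee[\mathtt{P}](\Psi;\varphi\wedge\neg\gamma)$ - (Bot) $\neg[\mathtt{P}](\bot;\varphi)$ - (Non-Em) $[\mathtt{P}]\top$ - (Inst) $[\mathtt{P}](\psi;\top)\leftrightarrow[\overline{\mathtt{P}}](\psi;\top)$ - (Cons) $[\mathtt{P}]\varphi\to\neg[\overline{\mathtt{P}}]\neg\varphi$ and as rules modus ponens and replacement of equivalents (from $\varphi\leftrightarrow\psi$ and $\theta$ infer any formula obtained from $\theta$ by replacing some occurrences of $\psi$ by $\varphi$). An instantial game model consists of a set $W$, relations $R_{\mathtt{A}},R_{\mathtt{B}}\subseteq W\times\mathcal{P}(W)$ and a valuation $V:\mathsf{Prop}\to\mathcal{P}(W)$ such that for all $u\in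 W$ and both players $\mathtt{P}$: $R_{\mathtt{P}}[u]\neq\emptyset$ (Non-emptiness); if $x\in Z\in R_{\mathtt{P}}[u]$ then $x\in Z'$ for some $Z'\in R_{\overline{\mathtt{P}}}[u]$ (Instantiatedness); if $Z\in R_{\mathtt{A}}[u]$ and $Z'\in R_{\mathtt{B}}[u]$ then $Z\cap Z'\neq\emptyset$ (Consistency). Variables and Boolean connectives are interpreted as usual, and $[\mathtt{P}](\psi_1,\dots,\psi_n;\varphi)$ is true at $u$ iff there is $Z\in R_{\mathtt{P}}[u]$ such that $\varphi$ is true at every point of $Z$ and each $\psi_i$ is true at some point of $Z$. **Theorem.** The logic $\mathbf{IGL}$ is decidable and has the effective finite model property. That is: 1. There is an algorithm that, given (the Gödel number of) a formula $\varphi$, decides whether $\mathbf{IGL}\vdash\varphi$. 2. There is a computable function $f:\mathbb{N}\to\mathbb{N}$ such that for every formula $\varphi$: if $\mathbf{IGL}\vdash\varphi$, then $\varphi$ is true at every world of every instantial game model; and if $\mathbf{IGL}\nvdash\varphi$, then $\varphi$ is false at some world of some instantial game model with at most $f(|\varphi|)$ worlds. -/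

import Mathlib

namespace InstantialGame

/-- The two players. -/
inductive Player : Type where
  | A : Player
  | B : Player

/-- The opponent of a player. -/
def Player.other : Player → Player
  | .A => .B
  | .B => .A

/-- Formulas of instantial game logic over a set `α` of propositional variables.
`box P Ψ φ` is the formula `[P](ψ₁, …, ψₙ; φ)`. The finite set `{ψ₁, …, ψₙ}` is presented by an
enumeration `Ψ : Fin n → Formula α` (`n = 0` is the empty set); only the range of `Ψ` matters, both
for the truth definition and, by the axiom `weak` below, for provability. -/
inductive Formula (α : Type*) : Type _ where
  | var : α → Formula α
  | neg : Formula α → Formula α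
  | and : Formula α → Formula α → Formula α
  | box : Player → {n : ℕ} → (Fin n → Formula α) → Formula α → Formula α

namespace Formula

variable {α : Type*}

/-- `φ ∨ ψ` -/
def or (φ ψ : Formula α) : Formula α := neg (and (neg φ) (neg ψ))

/-- `φ → ψ` -/
def imp (φ ψ : Formula α) : Formula α := neg (and φ (neg ψ))

/-- `φ ↔ ψ` -/
def iff (φ ψ : Formula α) : Formula α := and (imp φ ψ) (imp ψ φ)

/-- `⊥`, written with the help of an arbitrary formula `χ` as `χ ∧ ¬χ`. -/
def bot (χ : Formula α) : Formula α := and χ (neg χ)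

/-- `⊤`, written with the help of an arbitrary formula `χ` as `¬(χ ∧ ¬χ)`. -/
def top (χ : Formula α) : Formula α := neg (bot χ)

/-- `[P]φ`, that is `[P](∅; φ)` -/
def box₀ (P : Player) (φ : Formula α) : Formula α := box P (![] : Fin 0 → Formula α) φ

/-- `[P](ψ; φ)`, that is `[P]({ψ}; φ)` -/
def box₁ (P : Player) (ψ φ : Formula α) : Formula α := box P ![ψ] φ

/-- The size of a formula: the number of occurrences of variables and connectives. -/
def size : Formula α → ℕ
  | var _ => 1
  | neg φ => φ.size + 1
  | and φ ψ => φ.size + ψ.size + 1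
  | box _ Ψ φ => (∑ i, (Ψ i).size) + φ.size + 1

/-- The Gödel number of a formula, relative to a numbering of the propositional variables. -/
def code [Encodable α] : Formula α → ℕ
  | var a => Nat.pair 0 (Encodable.encode a)
  | neg φ => Nat.pair 1 φ.code
  | and φ ψ => Nat.pair 2 (Nat.pair φ.code ψ.code)
  | box .A Ψ φ => Nat.pair 3 (Nat.pair (Encodable.encode (List.ofFn fun i => (Ψ i).code)) φ.code)
  | box .B Ψ φ => Nat.pair 4 (Nat.pair (Encodable.encode (List.ofFn fun i => (Ψ i).code)) φ.code)

/-- Distinct formulas have distinct Gödel numbers. -/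
theorem code_injective [Encodable α] : Function.Injective (code : Formula α → ℕ) := by
  intro φ
  induction φ with
  | var a =>
    rintro (b | ψ | ⟨ψ, χ⟩ | ⟨_ | _, Ψ, ψ⟩) h <;> simp_all [code, Nat.pair_eq_pair]
  | neg φ ih =>
    rintro (b | ψ | ⟨ψ, χ⟩ | ⟨_ | _, Ψ, ψ⟩) h <;> simp [code, Nat.pair_eq_pair] at h
    rw [ih h]
  | and φ φ' ih ih' =>
    rintro (b | ψ | ⟨ψ, χ⟩ | ⟨_ | _, Ψ, ψ⟩) h <;> simp [code, Nat.pair_eq_pair] at h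
    rw [ih h.1, ih' h.2]
  | @box P n Φ φ ihΦ ih =>
    rintro (b | ψ | ⟨ψ, χ⟩ | ⟨Q, Ψ, ψ⟩) h
    · cases P <;> simp_all [code, Nat.pair_eq_pair]
    · cases P <;> simp_all [code, Nat.pair_eq_pair]
    · cases P <;> simp_all [code, Nat.pair_eq_pair]
    · rename_i m
      have key : P = Q ∧ (List.ofFn fun i => (Φ i).code) = (List.ofFn fun i => (Ψ i).code) ∧
          φ.code = ψ.code := by
        cases P <;> cases Q <;> simp only [code, Nat.pair_eq_pair] at h
        · exact ⟨rfl, Encodable.encode_injective h.2.1, h.2.2⟩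
        · exact absurd h.1 (by decide)
        · exact absurd h.1 (by decide)
        · exact ⟨rfl, Encodable.encode_injective h.2.1, h.2.2⟩
      obtain ⟨rfl, hl, hc⟩ := key
      have hnm : n = m := by simpa using congrArg List.length hl
      subst hnm
      have hΨ : Φ = Ψ := funext fun i => ihΦ i (congrFun (List.ofFn_injective hl) i)
      rw [hΨ, ih hc]

/-- Propositional tautologies: formulas true under every Boolean valuation that treats variables
and modal formulas as atoms. -/
def IsTautology (φ : Formula α) : Prop :=
  ∀ v : Formula α → Prop,
    (∀ ψ, v (neg ψ) ↔ ¬ v ψ) → (∀ ψ χ, v (and ψ χ) ↔ v ψ ∧ v χ) → v φ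

/-- `Replace φ ψ θ θ₁`: the formula `θ₁` results from `θ` by replacing some (possibly none)
occurrences of `ψ` by `φ`. -/
inductive Replace (φ ψ : Formula α) : Formula α → Formula α → Prop
  | keep (θ : Formula α) : Replace φ ψ θ θ
  | here : Replace φ ψ ψ φ
  | neg {θ θ₁ : Formula α} : Replace φ ψ θ θ₁ → Replace φ ψ (neg θ) (neg θ₁)
  | and {θ θ₁ χ χ₁ : Formula α} :
      Replace φ ψ θ θ₁ → Replace φ ψ χ χ₁ → Replace φ ψ (and θ χ) (and θ₁ χ₁)
  | box (P : Player) {n : ℕ} {Θ Θ₁ : Fin n → Formula α} {χ χ₁ : Formula α} :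
      (∀ i, Replace φ ψ (Θ i) (Θ₁ i)) → Replace φ ψ χ χ₁ →
      Replace φ ψ (box P Θ χ) (box P Θ₁ χ₁)

end Formula

open Formula in
/-- Provability in the axiom system **IGL** (over classical propositional logic). -/
inductive Provable {α : Type*} : Formula α → Prop
  | taut {φ : Formula α} : IsTautology φ → Provable φ
  | mon (P : Player) {n : ℕ} (Ψ Γ : Fin n → Formula α) (φ β : Formula α) :
      Provable (imp (box P Ψ φ) (box P (fun i => or (Ψ i) (Γ i)) (or φ β)))
  | weak (P : Player) {n m : ℕ} (Ψ : Fin n → Formula α) (Ψ₁ : Fin m → Formula α) (φ : Formula α) :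
      Set.range Ψ₁ ⊆ Set.range Ψ → Provable (imp (box P Ψ φ) (box P Ψ₁ φ))
  | un (P : Player) {n : ℕ} (Ψ : Fin n → Formula α) (φ : Formula α) :
      Provable (imp (box P Ψ φ) (box P (fun i => and (Ψ i) φ) φ))
  | lem (P : Player) {n : ℕ} (Ψ : Fin n → Formula α) (φ γ : Formula α) :
      Provable (imp (box P Ψ φ)
        (or (box P (Matrix.vecCons γ Ψ) φ) (box P Ψ (and φ (neg γ)))))
  | bot (P : Player) (χ φ : Formula α) : Provable (neg (box₁ P (bot χ) φ))
  | nonEm (P : Player) (χ : Formula α) : Provable (box₀ P (top χ))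
  | inst (P : Player) (ψ χ : Formula α) :
      Provable (iff (box₁ P ψ (top χ)) (box₁ P.other ψ (top χ)))
  | cons (P : Player) (φ : Formula α) :
      Provable (imp (box₀ P φ) (neg (box₀ P.other (neg φ))))
  | mp {φ ψ : Formula α} : Provable (imp φ ψ) → Provable φ → Provable ψ
  | re {φ ψ θ θ₁ : Formula α} :
      Provable (iff φ ψ) → Provable θ → Replace φ ψ θ θ₁ → Provable θ₁

/-- An instantial game frame on `W`: `Z ∈ R P u` means that `Z` is a basic power of player `P`
at `u`. -/
structure Frame (W : Type*) where
  R : Player → W → Set (Set W)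
  nonempty : ∀ P u, (R P u).Nonempty
  instantiated : ∀ P u, ∀ Z ∈ R P u, ∀ x ∈ Z, ∃ Z₁ ∈ R P.other u, x ∈ Z₁
  consistent : ∀ u, ∀ Z ∈ R .A u, ∀ Z₁ ∈ R .B u, (Z ∩ Z₁).Nonempty

/-- An instantial game model: an instantial game frame with a valuation. -/
structure Model (α W : Type*) extends Frame W where
  V : α → Set W

/-- Truth of a formula at a world of an instantial game model. -/
def Model.Sat {α W : Type*} (M : Model α W) : W → Formula α → Prop
  | u, .var a => u ∈ M.V a
  | u, .neg φ => ¬ M.Sat u φ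
  | u, .and φ ψ => M.Sat u φ ∧ M.Sat u ψ
  | u, .box P Ψ φ =>
      ∃ Z ∈ M.R P u, (∀ v ∈ Z, M.Sat v φ) ∧ ∀ i, ∃ v ∈ Z, M.Sat v (Ψ i)

/-- A set of formulas is decidable if some algorithm decides, given the Gödel number of a formula,
whether the formula belongs to the set. -/
def DecidableSet {α : Type*} [Encodable α] (S : Set (Formula α)) : Prop :=
  ∃ d : ℕ → Bool, Computable d ∧ ∀ φ : Formula α, d φ.code = true ↔ φ ∈ S

end InstantialGame

/-! Soundness is an induction on derivations. Completeness uses a finite canonical model. The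
maximal consistent sets are divided into classes according to the subformulas of the refuted formula
that they contain; each class `z` keeps one representative `c z` and has a characteristic formula `γ
z`, so every maximal consistent set contains exactly one `γ z`. A set `Z` of classes is a power of
`P` at `u` when `c u` contains some `[P](Ψ; φ)` such that every `γ z` with `z ∈ Z` occurs in `Ψ` and
`φ` entails the disjunction of these `γ z`.

The crux is that every true modal formula is realised by such a `Z` (`exists_mem_canonicalPower`).
Repeated use of (Lem) makes each `γ z` either an instance or incompatible with the scope, and `Z`
consists of the classes compatible with the refined scope. (Un) and (Bot) place the original
instances in `Z`; (Inst) and (Cons) give the frame conditions; (Mon) and (Weak) give the converse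
half of the truth lemma.

There are at most `2 ^ φ.size` classes, so unprovability amounts to a countermodel of bounded size.
A model, with its truth relation, is packed into the binary digits of one bounded number, and the
search for it is primitive recursive. -/

namespace InstantialGame

open Formula

variable {α : Type*}

/-! ### Soundness -/

/-- A modality looks at truth in other worlds, so the equivalence is assumed at all worlds and not
only at `u`. -/
theorem Model.sat_replace_iff {W : Type*} (M : Model α W) {φ ψ θ θ₁ : Formula α}
    (h : ∀ u, M.Sat u φ ↔ M.Sat u ψ) (hr : Replace φ ψ θ θ₁) :
    ∀ u, M.Sat u θ ↔ M.Sat u θ₁ := by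
  induction hr with
  | keep θ => exact fun u => Iff.rfl
  | here => exact fun u => (h u).symm
  | neg _ ih => exact fun u => not_congr (ih u)
  | and _ _ ih ih' => exact fun u => and_congr (ih u) (ih' u)
  | box P _ _ ih ih' => intro u; simp only [Model.Sat, ih, ih']

/-- Provable formulas are true at every world of every model. -/
theorem Provable.sat {φ : Formula α} (h : Provable φ) {W : Type*} (M : Model α W) :
    ∀ w, M.Sat w φ := by
  induction h with
  | taut h => exact fun w => h (M.Sat w) (fun _ => Iff.rfl) fun _ _ => Iff.rfl
  | mon P Ψ Γ φ β =>
    intro w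
    simp only [imp, Formula.or, Model.Sat, not_and, not_not]
    rintro ⟨Z, hZ, h1, h2⟩
    refine ⟨Z, hZ, fun v hv h => absurd (h1 v hv) h, fun i => ?_⟩
    obtain ⟨v, hv, h⟩ := h2 i
    exact ⟨v, hv, fun h' => absurd h h'⟩
  | weak P Ψ Ψ₁ φ hr =>
    intro w
    simp only [imp, Model.Sat, not_and, not_not]
    rintro ⟨Z, hZ, h1, h2⟩
    refine ⟨Z, hZ, h1, fun i => ?_⟩
    obtain ⟨j, hj⟩ := hr ⟨i, rfl⟩
    exact hj ▸ h2 j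
  | un P Ψ φ =>
    intro w
    simp only [imp, Model.Sat, not_and, not_not]
    rintro ⟨Z, hZ, h1, h2⟩
    refine ⟨Z, hZ, h1, fun i => ?_⟩
    obtain ⟨v, hv, h⟩ := h2 i
    exact ⟨v, hv, h, h1 v hv⟩
  | lem P Ψ φ γ =>
    intro w
    simp only [imp, Formula.or, Model.Sat, not_and, not_not]
    rintro ⟨Z, hZ, h1, h2⟩ hn
    refine ⟨Z, hZ, fun v hv => ⟨h1 v hv, fun hγ => hn ⟨Z, hZ, h1, ?_⟩⟩, h2⟩
    exact Fin.cases ⟨v, hv, hγ⟩ h2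
  | bot P χ φ =>
    rintro w ⟨Z, -, -, h⟩
    obtain ⟨v, -, h1, h2⟩ := h 0
    exact h2 h1
  | nonEm P χ =>
    intro w
    obtain ⟨Z, hZ⟩ := M.nonempty P w
    exact ⟨Z, hZ, fun v _ h => h.2 h.1, fun i => i.elim0⟩
  | inst P ψ χ =>
    intro w
    have key : ∀ Q, M.Sat w (box₁ Q ψ (top χ)) → M.Sat w (box₁ Q.other ψ (top χ)) := by
      rintro Q ⟨Z, hZ, -, h⟩
      obtain ⟨v, hv, hψ⟩ := h 0
      obtain ⟨Z₁, hZ₁, hv₁⟩ := M.instantiated Q w Z hZ v hv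
      refine ⟨Z₁, hZ₁, fun v _ h => h.2 h.1, fun i => ⟨v, hv₁, ?_⟩⟩
      rwa [Subsingleton.elim i 0]
    have key' := key P.other
    rw [show P.other.other = P by cases P <;> rfl] at key'
    exact ⟨fun h => h.2 (key P h.1), fun h => h.2 (key' h.1)⟩
  | cons P φ =>
    rintro w ⟨⟨Z, hZ, h1, -⟩, h⟩
    refine h fun h => ?_
    obtain ⟨Z₁, hZ₁, h2, -⟩ := h
    obtain ⟨x, hx, hx₁⟩ : (Z ∩ Z₁).Nonempty := by
      cases P
      · exact M.consistent w Z hZ Z₁ hZ₁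
      · exact Set.inter_comm Z Z₁ ▸ M.consistent w Z₁ hZ₁ Z hZ
    exact h2 x hx₁ (h1 x hx)
  | mp _ _ ih ih' =>
    intro w
    by_contra h
    exact ih w ⟨ih' w, h⟩
  | re _ _ hr ih ih' =>
    intro w
    refine (M.sat_replace_iff (fun u => ?_) hr w).1 (ih' w)
    have := ih u
    simp only [Formula.iff, imp, Model.Sat, not_and, not_not] at this
    exact ⟨this.1, this.2⟩

/-! ### Maximal consistent sets -/

/-- Maximal consistent sets of formulas, given as predicates. -/
structure IsMCS (v : Formula α → Prop) : Prop where
  neg : ∀ ψ, v (neg ψ) ↔ ¬ v ψ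
  and : ∀ ψ χ, v (and ψ χ) ↔ v ψ ∧ v χ
  prov : ∀ ψ, Provable ψ → v ψ

namespace IsMCS

variable {v : Formula α → Prop} (hv : IsMCS v)
include hv

theorem imp (φ ψ : Formula α) : v (imp φ ψ) ↔ (v φ → v ψ) := by
  simp [Formula.imp, hv.neg, hv.and]

theorem or (φ ψ : Formula α) : v (or φ ψ) ↔ (v φ ∨ v ψ) := by
  simp only [Formula.or, hv.neg, hv.and]; tauto

theorem iff (φ ψ : Formula α) : v (iff φ ψ) ↔ (v φ ↔ v ψ) := by
  simp only [Formula.iff, hv.and, hv.imp]; tauto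

theorem top (χ : Formula α) : v (top χ) := by
  simp [Formula.top, Formula.bot, hv.neg, hv.and]

theorem mp {φ ψ : Formula α} (h : Provable (Formula.imp φ ψ)) (hφ : v φ) : v ψ :=
  (hv.imp φ ψ).1 (hv.prov _ h) hφ

end IsMCS

/-- Lindenbaum's lemma. -/
theorem exists_isMCS_not {φ : Formula α} (hφ : ¬ Provable φ) :
    ∃ v : Formula α → Prop, IsMCS v ∧ ¬ v φ := by
  -- Theories are closed under modus ponens only: replacement of equivalents preserves theoremhood
  -- but is not a local inference.
  let 𝒯 : Set (Set (Formula α)) :=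
    {T | (∀ ψ, Provable ψ → ψ ∈ T) ∧ (∀ ψ χ, imp ψ χ ∈ T → ψ ∈ T → χ ∈ T) ∧ φ ∉ T}
  obtain ⟨T, -, hT⟩ := zorn_subset_nonempty 𝒯 (by
    rintro c hc hchain ⟨T₀, hT₀⟩
    refine ⟨⋃₀ c, ⟨fun ψ hψ => ⟨T₀, hT₀, (hc hT₀).1 ψ hψ⟩, ?_, ?_⟩,
      fun s hs => Set.subset_sUnion_of_mem hs⟩
    · rintro ψ χ ⟨T₁, h₁, hi⟩ ⟨T₂, h₂, hp⟩
      rcases hchain.total h₁ h₂ with h | h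
      · exact ⟨T₂, h₂, (hc h₂).2.1 ψ χ (h hi) hp⟩
      · exact ⟨T₁, h₁, (hc h₁).2.1 ψ χ hi (h hp)⟩
    · rintro ⟨T₁, h₁, h⟩
      exact (hc h₁).2.2 h) {ψ | Provable ψ} ⟨fun _ h => h, fun _ _ => Provable.mp, hφ⟩
  obtain ⟨⟨hprov, hmp, hφT⟩, hmax⟩ := hT
  have taut : ∀ ψ, IsTautology ψ → ψ ∈ T := fun ψ h => hprov ψ (.taut h)
  have ext : ∀ ψ, ψ ∉ T → imp ψ φ ∈ T := by
    intro ψ hψ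
    by_contra hn
    -- The formulas that `ψ` implies modulo `T` form a theory extending `T` and containing `ψ`; if
    -- it omitted `φ`, maximality would put `ψ` in `T`.
    have hle : T ⊆ {χ | imp ψ χ ∈ T} := fun χ hχ =>
      hmp χ _ (taut _ (by intro v hn ha; simp only [imp, hn, ha]; tauto)) hχ
    refine hψ (hmax ⟨fun χ hχ => hle (hprov χ hχ), fun χ ξ h1 h2 => ?_, hn⟩ hle ?_)
    · exact hmp _ _ (hmp _ _ (taut (imp (imp ψ (imp χ ξ)) (imp (imp ψ χ) (imp ψ ξ)))
        (by intro v hn ha; simp only [imp, hn, ha]; tauto)) h1) h2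
    · exact taut _ (by intro v hn ha; simp only [imp, hn, ha]; tauto)
  have hneg : ∀ ψ, neg ψ ∈ T ↔ ψ ∉ T := by
    refine fun ψ => ⟨fun h h' => hφT ?_, fun h => ?_⟩
    · exact hmp _ _ (hmp _ _ (taut (imp ψ (imp (neg ψ) φ))
        (by intro v hn ha; simp only [imp, hn, ha]; tauto)) h') h
    · by_contra h'
      exact hφT (hmp _ _ (hmp _ _ (taut (imp (imp ψ φ) (imp (imp (neg ψ) φ) φ))
        (by intro v hn ha; simp only [imp, hn, ha]; tauto)) (ext _ h)) (ext _ h'))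
  refine ⟨fun ψ => ψ ∈ T, ⟨hneg, fun ψ χ => ⟨fun h => ⟨?_, ?_⟩, fun h => ?_⟩, hprov⟩, hφT⟩
  · exact hmp _ _ (taut _ (by intro v hn ha; simp only [imp, hn, ha]; tauto)) h
  · exact hmp _ _ (taut _ (by intro v hn ha; simp only [imp, hn, ha]; tauto)) h
  · exact hmp _ _ (hmp _ _ (taut (imp ψ (imp χ (and ψ χ)))
      (by intro v hn ha; simp only [imp, hn, ha]; tauto)) h.1) h.2

/-- Truth in all maximal consistent sets that contain the premise. -/
def Entails (φ ψ : Formula α) : Prop := ∀ v, IsMCS v → v φ → v ψ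

/-- Turns Boolean reasoning inside maximal consistent sets into derivations. -/
theorem provable_of_forall_isMCS {φ : Formula α} (h : ∀ v, IsMCS v → v φ) : Provable φ := by
  by_contra hφ
  obtain ⟨v, hv, hn⟩ := exists_isMCS_not hφ
  exact hn (h v hv)

/-- The rule `re` acts on theorems, so it is applied to `θ → θ`, changing only the right-hand
occurrence. -/
theorem IsMCS.replace {w : Formula α → Prop} (hw : IsMCS w) {φ ψ θ θ₁ : Formula α}
    (h : ∀ v, IsMCS v → (v φ ↔ v ψ)) (hr : Replace φ ψ θ θ₁) (hθ : w θ) : w θ₁ := by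
  have h1 : Provable (Formula.iff φ ψ) :=
    provable_of_forall_isMCS fun v hv => (hv.iff φ ψ).2 (h v hv)
  have h2 : Provable (Formula.imp θ θ) :=
    provable_of_forall_isMCS fun v hv => (hv.imp θ θ).2 id
  exact hw.mp (.re h1 h2 (.neg (.and (.keep _) (.neg hr)))) hθ

theorem IsMCS.box_congr {w : Formula α → Prop} (hw : IsMCS w) {P : Player} {n : ℕ}
    {Ψ Ψ₁ : Fin n → Formula α} {φ φ₁ : Formula α}
    (hΨ : ∀ i, ∀ v, IsMCS v → (v (Ψ₁ i) ↔ v (Ψ i))) (hφ : ∀ v, IsMCS v → (v φ₁ ↔ v φ))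
    (h : w (box P Ψ φ)) : w (box P Ψ₁ φ₁) := by
  -- Each replacement handles a single pair of equivalents, so the instances are exchanged one index
  -- at a time.
  have key : ∀ s : Finset (Fin n), w (box P (s.piecewise Ψ₁ Ψ) φ) := by
    intro s
    induction s using Finset.induction_on with
    | empty => simpa using h
    | insert i s hi ih =>
      refine hw.replace (hΨ i) (.box P (fun j => ?_) (.keep _)) ih
      rw [Finset.piecewise_insert]
      rcases eq_or_ne j i with rfl | hj
      · simpa [hi] using Replace.here
      · simpa [hj] using Replace.keep _
  have := key Finset.univ
  rw [Finset.piecewise_univ] at this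
  exact hw.replace hφ (.box P (fun _ => .keep _) .here) this

/-- Monotonicity of the modalities, combined with weakening. -/
theorem IsMCS.box_mono {w : Formula α → Prop} (hw : IsMCS w) {P : Player} {n m : ℕ}
    {Ψ : Fin n → Formula α} {Ψ₁ : Fin m → Formula α} {φ φ₁ : Formula α}
    (hΨ : ∀ j, ∃ i, Entails (Ψ i) (Ψ₁ j)) (hφ : Entails φ φ₁)
    (h : w (box P Ψ φ)) : w (box P Ψ₁ φ₁) := by
  choose f hf using hΨ
  have h1 : w (box P (fun j => Ψ (f j)) φ) :=
    hw.mp (.weak P Ψ _ φ (by rintro _ ⟨j, rfl⟩; exact ⟨f j, rfl⟩)) h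
  -- (Mon) yields disjunctions `Ψ (f j) ∨ Ψ₁ j` and `φ ∨ φ₁`, which collapse to their second members
  -- by the assumed entailments.
  refine hw.box_congr (fun j v hv => ?_) (fun v hv => ?_) (hw.mp (.mon P _ Ψ₁ φ φ₁) h1)
  · rw [hv.or]; exact ⟨Or.inr, fun h => h.elim (hf j v hv) id⟩
  · rw [hv.or]; exact ⟨Or.inr, fun h => h.elim (hφ v hv) id⟩

/-- The instances of a true modal formula are consistent with its scope. -/
theorem IsMCS.exists_of_box {w : Formula α → Prop} (hw : IsMCS w) {P : Player} {n : ℕ}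
    {Ψ : Fin n → Formula α} {φ : Formula α} (h : w (box P Ψ φ)) (i : Fin n) :
    ∃ v, IsMCS v ∧ v (Ψ i) ∧ v φ := by
  by_contra! hn
  -- After (Un) the `i`-th instance is `Ψ i ∧ φ`; if that were inconsistent, monotonicity would give
  -- a formula refuted by (Bot).
  refine (hw.neg _).1 (hw.prov _ (.bot P φ φ)) ?_
  refine hw.box_mono (fun j => ⟨i, fun v hv h => ?_⟩) (fun _ _ h => h) (hw.mp (.un P Ψ φ) h)
  rw [hv.and] at h
  exact absurd h.2 (hn v hv h.1)

/-- Iterated use of the axiom `lem`. -/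
theorem IsMCS.exists_box_decided {w : Formula α → Prop} (hw : IsMCS w) {P : Player} {n : ℕ}
    {Ψ : Fin n → Formula α} {φ : Formula α} (h : w (box P Ψ φ)) (X : List (Formula α)) :
    ∃ (m : ℕ) (Ψ₁ : Fin m → Formula α) (φ₁ : Formula α), w (box P Ψ₁ φ₁) ∧
      (∀ i, ∃ j, Ψ₁ j = Ψ i) ∧ Entails φ₁ φ ∧
      ∀ γ ∈ X, (∃ j, Ψ₁ j = γ) ∨ ∀ v, IsMCS v → v φ₁ → ¬ v γ := by
  induction X with
  | nil => exact ⟨n, Ψ, φ, h, fun i => ⟨i, rfl⟩, fun _ _ h => h, by simp⟩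
  | cons γ X ih =>
    obtain ⟨m, Ψ₁, φ₁, h1, h2, h3, h4⟩ := ih
    rcases (hw.or _ _).1 (hw.mp (.lem P Ψ₁ φ₁ γ) h1) with h5 | h5
    · refine ⟨_, _, _, h5, fun i => (h2 i).imp' Fin.succ fun j hj => by simpa using hj, h3, ?_⟩
      intro δ hδ
      rcases List.mem_cons.1 hδ with rfl | hδ
      · exact .inl ⟨0, rfl⟩
      · exact (h4 δ hδ).imp_left fun ⟨j, hj⟩ => ⟨j.succ, by simpa using hj⟩
    · refine ⟨_, _, _, h5, h2, fun v hv h => h3 v hv ((hv.and _ _).1 h).1, fun δ hδ => ?_⟩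
      rcases List.mem_cons.1 hδ with rfl | hδ
      · exact .inr fun v hv h => (hv.neg _).1 ((hv.and _ _).1 h).2
      · exact (h4 δ hδ).imp_right fun h v hv h' => h v hv ((hv.and _ _).1 h').1

/-! ### The finite canonical model -/

/-- The list of subformulas of a formula. -/
def Formula.subs : Formula α → List (Formula α)
  | var a => [var a]
  | neg φ => neg φ :: φ.subs
  | and φ ψ => and φ ψ :: (φ.subs ++ ψ.subs)
  | box P Ψ φ => box P Ψ φ :: ((List.ofFn fun i => (Ψ i).subs).flatten ++ φ.subs)

theorem Formula.length_subs (φ : Formula α) : φ.subs.length = φ.size := by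
  induction φ with
  | var a => rfl
  | neg φ ih => simp [subs, size, ih]
  | and φ ψ ih ih' => simp [subs, size, ih, ih']
  | box P Ψ φ ih ih' =>
    simp [subs, size, ih', List.length_flatten, List.map_ofFn, Function.comp_def, ih,
      List.sum_ofFn]

theorem Formula.mem_subs_self (φ : Formula α) : φ ∈ φ.subs := by
  cases φ <;> simp [subs]

/-- Choice of one maximal consistent set for each consistent pattern on a list of formulas. -/
theorem exists_isMCS_representatives (s : List (Formula α)) :
    ∃ n ≤ 2 ^ s.length, ∃ c : Fin n → Formula α → Prop, (∀ z, IsMCS (c z)) ∧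
      ∀ v, IsMCS v → ∃! z, ∀ ψ ∈ s, (v ψ ↔ c z ψ) := by
  classical
  let pat (v : Formula α → Prop) : Fin s.length → Bool := fun i => decide (v (s.get i))
  let W : Type := {p : Fin s.length → Bool // ∃ v, IsMCS v ∧ pat v = p}
  have hpat : ∀ v v' : Formula α → Prop, pat v = pat v' ↔ ∀ ψ ∈ s, (v ψ ↔ v' ψ) := by
    intro v v'
    simp only [pat, funext_iff, decide_eq_decide]
    exact ⟨fun h ψ hψ => by obtain ⟨i, rfl⟩ := List.get_of_mem hψ; exact h i,
      fun h i => h _ (s.get_mem i)⟩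
  let e : Fin (Fintype.card W) ≃ W := (Fintype.equivFin W).symm
  refine ⟨Fintype.card W, ?_, fun z => (e z).2.choose, fun z => (e z).2.choose_spec.1, ?_⟩
  · exact (Fintype.card_subtype_le _).trans (by simp)
  · intro v hv
    have hc : ∀ z, pat ((e z).2.choose) = (e z).1 := fun z => (e z).2.choose_spec.2
    refine ⟨e.symm ⟨pat v, v, hv, rfl⟩, ?_, fun z hz => ?_⟩
    · exact (hpat _ _).1 (by rw [hc, e.apply_symm_apply])
    · rw [Equiv.eq_symm_apply]
      exact Subtype.ext ((hc z).symm.trans ((hpat _ _).2 hz).symm)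

/-- The conjunction of the formulas of `s` true in `c` and the negations of the others. -/
theorem exists_characteristic (χ : Formula α) (s : List (Formula α)) (c : Formula α → Prop) :
    ∃ γ : Formula α, ∀ v, IsMCS v → (v γ ↔ ∀ ψ ∈ s, (v ψ ↔ c ψ)) := by
  induction s with
  | nil => exact ⟨top χ, fun v hv => by simp [hv.top]⟩
  | cons ψ s ih =>
    obtain ⟨γ, hγ⟩ := ih
    by_cases h : c ψ
    · exact ⟨and ψ γ, fun v hv => by simp [hv.and, hγ v hv, h]⟩
    · exact ⟨and (neg ψ) γ, fun v hv => by simp [hv.and, hv.neg, hγ v hv, h]⟩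

section Canonical

variable {n : ℕ} (c : Fin n → Formula α → Prop) (γ : Fin n → Formula α)

/-- The basic powers at a world of the finite canonical model. -/
def canonicalPower (P : Player) (u : Fin n) : Set (Set (Fin n)) :=
  {Z | ∃ (m : ℕ) (Ψ : Fin m → Formula α) (φ : Formula α), c u (box P Ψ φ) ∧
    (∀ z ∈ Z, ∃ i, Ψ i = γ z) ∧ ∀ v, IsMCS v → v φ → ∃ z ∈ Z, v (γ z)}

variable {c γ}

/-- Once (Lem) has decided every `γ z`, a class compatible with the refined scope cannot be excluded
by it, so its `γ z` is an instance. These classes cover the scope because every maximal consistent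
set contains some `γ z`. -/
theorem exists_mem_canonicalPower (hc : ∀ z, IsMCS (c z))
    (hγ : ∀ v, IsMCS v → ∃ z, v (γ z)) {P : Player} {u : Fin n} {m : ℕ}
    {Ψ : Fin m → Formula α} {φ : Formula α} (h : c u (box P Ψ φ)) :
    ∃ Z ∈ canonicalPower c γ P u, (∀ z ∈ Z, ∃ v, IsMCS v ∧ v (γ z) ∧ v φ) ∧
      ∀ i, ∃ z ∈ Z, ∃ v, IsMCS v ∧ v (γ z) ∧ v (Ψ i) := by
  obtain ⟨k, Ψ₁, φ₁, h1, h2, h3, h4⟩ := (hc u).exists_box_decided h (List.ofFn γ)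
  refine ⟨{z | ∃ v, IsMCS v ∧ v (γ z) ∧ v φ₁}, ⟨k, Ψ₁, φ₁, h1, ?_, ?_⟩, ?_, ?_⟩
  · rintro z ⟨v, hv, hz, hφ⟩
    exact (h4 (γ z) (by simp)).resolve_right fun h => h v hv hφ hz
  · intro v hv hφ
    obtain ⟨z, hz⟩ := hγ v hv
    exact ⟨z, ⟨v, hv, hz, hφ⟩, hz⟩
  · rintro z ⟨v, hv, hz, hφ⟩
    exact ⟨v, hv, hz, h3 v hv hφ⟩
  · intro i
    obtain ⟨j, hj⟩ := h2 i
    obtain ⟨v, hv, hΨ, hφ⟩ := (hc u).exists_of_box h1 j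
    obtain ⟨z, hz⟩ := hγ v hv
    exact ⟨z, ⟨v, hv, hz, hφ⟩, v, hv, hz, hj ▸ hΨ⟩

/-- The finite canonical model with worlds represented by the maximal consistent sets `c z` and
characterised by the formulas `γ z`. -/
def canonicalModel (χ : Formula α) (hc : ∀ z, IsMCS (c z))
    (hγ : ∀ v, IsMCS v → ∃! z, v (γ z)) : Model α (Fin n) where
  R := canonicalPower c γ
  nonempty P u := by
    obtain ⟨Z, hZ, -⟩ := exists_mem_canonicalPower (P := P) hc (fun v hv => (hγ v hv).exists)
      ((hc u).prov _ (.nonEm P χ))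
    exact ⟨Z, hZ⟩
  instantiated P u := by
    rintro Z ⟨m, Ψ, φ, h1, h2, -⟩ x hx
    obtain ⟨i, hi⟩ := h2 x hx
    -- (Inst) moves the single instance `γ x` to the opponent. The resulting power has a class `z`
    -- with `γ z` and `γ x` jointly consistent, which forces `z = x`.
    have h3 : c u (box₁ P (γ x) (top χ)) :=
      (hc u).box_mono (fun j => ⟨i, fun v _ h => by
        rw [Subsingleton.elim j 0]; exact hi ▸ h⟩) (fun v hv _ => hv.top χ) h1
    have h4 := ((hc u).iff _ _).1 ((hc u).prov _ (.inst P (γ x) χ)) |>.1 h3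
    obtain ⟨Z₁, hZ₁, -, h5⟩ :=
      exists_mem_canonicalPower hc (fun v hv => (hγ v hv).exists) h4
    obtain ⟨z, hz, v, hv, hvz, hvx⟩ := h5 0
    exact ⟨Z₁, hZ₁, (hγ v hv).unique hvz hvx ▸ hz⟩
  consistent u := by
    rintro Z ⟨m, Ψ, φ, h1, -, h2⟩ Z₁ ⟨m₁, Ψ₁, φ₁, h1', -, h2'⟩
    by_contra hn
    -- If the two powers were disjoint, no maximal consistent set could contain both scopes, so `φ₁`
    -- would entail `¬φ`, against (Cons).
    have h3 : c u (box₀ .A φ) := (hc u).box_mono (fun j => j.elim0) (fun _ _ h => h) h1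
    refine ((hc u).neg _).1 ((hc u).mp (.cons .A φ) h3) ?_
    refine (hc u).box_mono (fun j => j.elim0) (fun v hv h => ?_) h1'
    rw [hv.neg]
    intro h'
    obtain ⟨z, hz, hvz⟩ := h2 v hv h'
    obtain ⟨z', hz', hvz'⟩ := h2' v hv h
    exact hn ⟨z, hz, (hγ v hv).unique hvz hvz' ▸ hz'⟩
  V a := {u | c u (var a)}

/-- The truth lemma. By `hs`, `γ z` settles every formula of `s` as `c z` does, so truth at the
classes in a power becomes entailment by their characteristic formulas. -/
theorem sat_canonicalModel_iff {χ : Formula α} {s : List (Formula α)} (hc : ∀ z, IsMCS (c z))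
    (hγ : ∀ v, IsMCS v → ∃! z, v (γ z))
    (hs : ∀ z v, IsMCS v → v (γ z) → ∀ ψ ∈ s, (v ψ ↔ c z ψ))
    (ψ : Formula α) :
    ψ.subs ⊆ s → ∀ u, (canonicalModel χ hc hγ).Sat u ψ ↔ c u ψ := by
  induction ψ with
  | var a => exact fun _ u => Iff.rfl
  | neg φ ih =>
    intro h u
    rw [subs, List.cons_subset] at h
    simp only [Model.Sat, ih h.2, (hc u).neg]
  | and φ ψ ih ih' =>
    intro h u
    rw [subs, List.cons_subset, List.append_subset] at h
    simp only [Model.Sat, ih h.2.1, ih' h.2.2, (hc u).and]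
  | box P Ψ φ ih ih' =>
    intro h u
    rw [subs, List.cons_subset, List.append_subset] at h
    have hΨ : ∀ i, (Ψ i).subs ⊆ s := fun i ξ hξ =>
      h.2.1 (List.mem_flatten.2 ⟨_, List.mem_ofFn.2 ⟨i, rfl⟩, hξ⟩)
    simp only [Model.Sat, ih' h.2.2, fun i => ih i (hΨ i)]
    have mφ := h.2.2 φ.mem_subs_self
    have mΨ := fun i => hΨ i (Ψ i).mem_subs_self
    constructor
    · rintro ⟨Z, ⟨m, Θ, θ, h1, h2, h3⟩, h4, h5⟩
      refine (hc u).box_mono (fun j => ?_) (fun v hv hθ => ?_) h1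
      · obtain ⟨z, hz, hzΨ⟩ := h5 j
        obtain ⟨i, hi⟩ := h2 z hz
        exact ⟨i, fun v hv hΘ => (hs z v hv (hi ▸ hΘ) _ (mΨ j)).2 hzΨ⟩
      · obtain ⟨z, hz, hvz⟩ := h3 v hv hθ
        exact (hs z v hv hvz _ mφ).2 (h4 z hz)
    · intro h
      obtain ⟨Z, hZ, h1, h2⟩ :=
        exists_mem_canonicalPower hc (fun v hv => (hγ v hv).exists) h
      refine ⟨Z, hZ, fun z hz => ?_, fun i => ?_⟩
      · obtain ⟨v, hv, hvz, hφ⟩ := h1 z hz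
        exact (hs z v hv hvz _ mφ).1 hφ
      · obtain ⟨z, hz, v, hv, hvz, hψ⟩ := h2 i
        exact ⟨z, hz, (hs z v hv hvz _ (mΨ i)).1 hψ⟩

end Canonical

/-- Completeness with respect to finite models of exponentially bounded size. -/
theorem exists_model_of_not_provable {φ : Formula α} (h : ¬ Provable φ) :
    ∃ n ≤ 2 ^ φ.size, ∃ (M : Model α (Fin n)) (w : Fin n), ¬ M.Sat w φ := by
  obtain ⟨n, hn, c, hc, hrep⟩ := exists_isMCS_representatives φ.subs
  choose γ hγ using fun z => exists_characteristic φ φ.subs (c z)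
  have hγ₁ : ∀ v, IsMCS v → ∃! z, v (γ z) := fun v hv => by
    simpa only [hγ _ v hv] using hrep v hv
  obtain ⟨v, hv, hφ⟩ := exists_isMCS_not h
  obtain ⟨z, hz, -⟩ := hrep v hv
  refine ⟨n, by rwa [← length_subs], canonicalModel φ hc hγ₁, z, ?_⟩
  rw [sat_canonicalModel_iff (s := φ.subs) hc hγ₁ (fun z v hv => (hγ z v hv).1)
    (ψ := φ) (List.Subset.refl _)]
  exact fun h' => hφ ((hz φ φ.mem_subs_self).2 h')

/-! ### Finite models coded by ternary relations on the natural numbers -/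

/-- The number of a player. -/
def Player.idx : Player → ℕ
  | .A => 0
  | .B => 1

/-- The list of natural numbers with a given code. -/
def decodeList (l : ℕ) : List ℕ := (Encodable.decode (α := List ℕ) l).getD []

theorem decodeList_encode (l : List ℕ) : decodeList (Encodable.encode l) = l := by
  simp [decodeList]

/-- The extra one per entry pays for the `+ 1` in `Formula.size_le_code`. -/
theorem sum_map_succ_le_encode (l : List ℕ) :
    (l.map (· + 1)).sum ≤ Encodable.encode l := by
  induction l with
  | nil => simp
  | cons a l ih =>
    have := Nat.add_le_pair a (Encodable.encode l)
    simp only [List.map_cons, List.sum_cons, Encodable.encode_list_cons, Nat.succ_eq_add_one,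
      Encodable.encode_nat]
    omega

theorem le_encode_of_mem {l : List ℕ} {a : ℕ} (h : a ∈ l) : a ≤ Encodable.encode l :=
  (Nat.le_succ a).trans <| (List.le_sum_of_mem (List.mem_map.2 ⟨a, h, rfl⟩)).trans
    (sum_map_succ_le_encode l)

theorem Formula.code_box [Encodable α] (P : Player) {n : ℕ} (Ψ : Fin n → Formula α)
    (φ : Formula α) : (box P Ψ φ).code =
      Nat.pair (P.idx + 3)
        (Nat.pair (Encodable.encode (List.ofFn fun i => (Ψ i).code)) φ.code) := by
  cases P <;> rfl

/-- Makes the bound on countermodels computable from the Gödel number alone. The `+ 1` is needed for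
a variable with code `0`. -/
theorem Formula.size_le_code [Encodable α] (φ : Formula α) : φ.size ≤ φ.code + 1 := by
  induction φ with
  | var a => simp [size]
  | neg φ ih =>
    have := Nat.add_le_pair 1 φ.code
    simp only [size, code]; omega
  | and φ ψ ih ih' =>
    have h1 := Nat.add_le_pair 2 (Nat.pair φ.code ψ.code)
    have h2 := Nat.add_le_pair φ.code ψ.code
    simp only [size, code]; omega
  | @box P n Ψ φ ih ih' =>
    have h1 := Nat.add_le_pair (P.idx + 3)
      (Nat.pair (Encodable.encode (List.ofFn fun i => (Ψ i).code)) φ.code)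
    have h2 := Nat.add_le_pair (Encodable.encode (List.ofFn fun i => (Ψ i).code)) φ.code
    have h3 := sum_map_succ_le_encode (List.ofFn fun i => (Ψ i).code)
    rw [List.map_ofFn, List.sum_ofFn] at h3
    have h4 : ∑ i, (Ψ i).size ≤ ∑ i, ((· + 1) ∘ fun i => (Ψ i).code) i :=
      Finset.sum_le_sum fun i _ => ih i
    rw [code_box]
    simp only [size]; omega

/-- `Q` codes an instantial game frame on the numbers below `n`: `Q p u z` says that the set of
binary digits of `z` is a basic power of the player with number `p` at `u`. -/
def FrameCoded (Q : ℕ → ℕ → ℕ → Prop) (n : ℕ) : Prop :=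
  (∀ p < 2, ∀ u < n, ∃ z < 2 ^ n, Q p u z) ∧
  (∀ p < 2, ∀ u < n, ∀ z < 2 ^ n, Q p u z → ∀ x < n, z.testBit x = true →
    ∃ z₁ < 2 ^ n, Q (1 - p) u z₁ ∧ z₁.testBit x = true) ∧
  (∀ u < n, ∀ z < 2 ^ n, Q 0 u z → ∀ z₁ < 2 ^ n, Q 1 u z₁ →
    ∃ x < n, z.testBit x = true ∧ z₁.testBit x = true)

/-- The truth clause for the formula with code `b`, where `Q 2 b u` says that this formula is true
at `u`, and `Q 3 b 0` that it is under consideration. -/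
def TruthCoded (Q : ℕ → ℕ → ℕ → Prop) (n b : ℕ) : Prop :=
  (b.unpair.1 = 1 → Q 3 b.unpair.2 0 ∧ ∀ u < n, (Q 2 b u ↔ ¬ Q 2 b.unpair.2 u)) ∧
  (b.unpair.1 = 2 → Q 3 b.unpair.2.unpair.1 0 ∧ Q 3 b.unpair.2.unpair.2 0 ∧
    ∀ u < n, (Q 2 b u ↔ Q 2 b.unpair.2.unpair.1 u ∧ Q 2 b.unpair.2.unpair.2 u)) ∧
  (3 ≤ b.unpair.1 → (∀ i ∈ decodeList b.unpair.2.unpair.1, Q 3 i 0) ∧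
    Q 3 b.unpair.2.unpair.2 0 ∧
    ∀ u < n, (Q 2 b u ↔ ∃ z < 2 ^ n, Q (b.unpair.1 - 3) u z ∧
      (∀ x < n, z.testBit x = true → Q 2 b.unpair.2.unpair.2 x) ∧
      ∀ i ∈ decodeList b.unpair.2.unpair.1, ∃ x < n, z.testBit x = true ∧ Q 2 i x))

/-- `Q` codes a model on the numbers below `n` in which the formula with code `c` is not true
everywhere. -/
def CountermodelCoded (Q : ℕ → ℕ → ℕ → Prop) (n c : ℕ) : Prop :=
  FrameCoded Q n ∧ (∀ b < c + 1, Q 3 b 0 → TruthCoded Q n b) ∧ Q 3 c 0 ∧ ∃ u < n, ¬ Q 2 c u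

/-- The set of binary digits of `z` below `n`. -/
def digitSet (n z : ℕ) : Set (Fin n) := {x | z.testBit x = true}

theorem exists_digitSet_eq {n : ℕ} (Z : Set (Fin n)) : ∃ z < 2 ^ n, digitSet n z = Z := by
  classical
  refine ⟨Nat.ofBits fun i => decide (i ∈ Z), Nat.ofBits_lt_two_pow _, Set.ext fun x => ?_⟩
  simp [digitSet]

theorem exists_player_of_lt_two {p : ℕ} (h : p < 2) : ∃ P : Player, P.idx = p := by
  interval_cases p
  exacts [⟨.A, rfl⟩, ⟨.B, rfl⟩]

theorem Player.idx_other (P : Player) : P.other.idx = 1 - P.idx := by cases P <;> rfl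

theorem frameCoded_of_model {n : ℕ} (M : Model α (Fin n)) {Q : ℕ → ℕ → ℕ → Prop}
    (hR : ∀ (P : Player) (u : Fin n), ∀ z < 2 ^ n, Q P.idx u z ↔ digitSet n z ∈ M.R P u) :
    FrameCoded Q n := by
  refine ⟨fun p hp u hu => ?_, fun p hp u hu z hz hQ x hx hzx => ?_,
    fun u hu z hz hQ z₁ hz₁ hQ₁ => ?_⟩
  · obtain ⟨P, rfl⟩ := exists_player_of_lt_two hp
    obtain ⟨Z, hZ⟩ := M.nonempty P ⟨u, hu⟩
    obtain ⟨z, hz, rfl⟩ := exists_digitSet_eq Z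
    exact ⟨z, hz, (hR P ⟨u, hu⟩ z hz).2 hZ⟩
  · obtain ⟨P, rfl⟩ := exists_player_of_lt_two hp
    obtain ⟨Z, hZ, hx₁⟩ :=
      M.instantiated P ⟨u, hu⟩ _ ((hR P ⟨u, hu⟩ z hz).1 hQ) ⟨x, hx⟩ hzx
    obtain ⟨z₁, hz₁, rfl⟩ := exists_digitSet_eq Z
    exact ⟨z₁, hz₁, P.idx_other ▸ (hR P.other ⟨u, hu⟩ z₁ hz₁).2 hZ, hx₁⟩
  · obtain ⟨x, h1, h2⟩ := M.consistent ⟨u, hu⟩ _ ((hR .A ⟨u, hu⟩ z hz).1 hQ) _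
      ((hR .B ⟨u, hu⟩ z₁ hz₁).1 hQ₁)
    exact ⟨x, x.2, h1, h2⟩

/-! ### Passing between models and their codes -/

section Decoding

variable [Encodable α]

/-- The model coded by a relation. -/
def FrameCoded.model {Q : ℕ → ℕ → ℕ → Prop} {n : ℕ} (h : FrameCoded Q n) : Model α (Fin n) where
  R P u := {Z | ∃ z < 2 ^ n, Q P.idx u z ∧ digitSet n z = Z}
  nonempty P u := by
    obtain ⟨z, hz, hQ⟩ := h.1 P.idx (by cases P <;> simp [Player.idx]) u u.2
    exact ⟨_, z, hz, hQ, rfl⟩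
  instantiated P u := by
    rintro _ ⟨z, hz, hQ, rfl⟩ x hx
    obtain ⟨z₁, hz₁, hQ₁, hx₁⟩ :=
      h.2.1 P.idx (by cases P <;> simp [Player.idx]) u u.2 z hz hQ x x.2 hx
    exact ⟨_, ⟨z₁, hz₁, by cases P <;> exact hQ₁, rfl⟩, hx₁⟩
  consistent u := by
    rintro _ ⟨z, hz, hQ, rfl⟩ _ ⟨z₁, hz₁, hQ₁, rfl⟩
    obtain ⟨x, hx, h1, h2⟩ := h.2.2 u u.2 z hz hQ z₁ hz₁ hQ₁
    exact ⟨⟨x, hx⟩, h1, h2⟩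
  V a := {u | Q 2 (code (var a)) u}

/-- The marks `Q 3` are closed under immediate subformulas, whose codes do not exceed `c`, so the
clauses reach all of `ψ`. Marking avoids having to decide which numbers code formulas: the numbering
of variables may have an undecidable range. -/
theorem FrameCoded.sat_model_iff {Q : ℕ → ℕ → ℕ → Prop} {n c : ℕ} (h : FrameCoded Q n)
    (ht : ∀ b < c + 1, Q 3 b 0 → TruthCoded Q n b) (ψ : Formula α) :
    ψ.code ≤ c → Q 3 ψ.code 0 → ∀ u, h.model.Sat u ψ ↔ Q 2 ψ.code u := by
  induction ψ with
  | var a => exact fun _ _ u => Iff.rfl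
  | neg φ ih =>
    intro hc hQ u
    have h1 := (ht _ (Nat.lt_succ_of_le hc) hQ).1
    simp only [code, Nat.unpair_pair, true_imp_iff] at h1
    have := ih ((Nat.right_le_pair _ _).trans hc) h1.1
    simp only [Model.Sat, this, code, h1.2 u u.2]
  | and φ ψ ih ih' =>
    intro hc hQ u
    have h1 := (ht _ (Nat.lt_succ_of_le hc) hQ).2.1
    simp only [code, Nat.unpair_pair, true_imp_iff] at h1
    have hc' := (Nat.right_le_pair _ _).trans hc
    have h2 := ih ((Nat.left_le_pair _ _).trans hc') h1.1
    have h3 := ih' ((Nat.right_le_pair _ _).trans hc') h1.2.1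
    simp only [Model.Sat, h2, h3, code, h1.2.2 u u.2]
  | box P Ψ φ ih ih' =>
    rw [code_box]
    intro hc hQ u
    have h1 := (ht _ (Nat.lt_succ_of_le hc) hQ).2.2
    simp only [Nat.unpair_pair, decodeList_encode, Nat.le_add_left, true_imp_iff,
      List.forall_mem_ofFn_iff, Nat.add_sub_cancel] at h1
    have hc' := (Nat.right_le_pair _ _).trans hc
    have h2 := ih' ((Nat.right_le_pair _ _).trans hc') h1.2.1
    have h3 := fun i => ih i
      ((le_encode_of_mem (List.mem_ofFn.2 ⟨i, rfl⟩)).trans ((Nat.left_le_pair _ _).trans hc'))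
      (h1.1 i)
    simp only [Model.Sat, h2, h3, h1.2.2 u u.2]
    constructor
    · rintro ⟨_, ⟨z, hz, hQz, rfl⟩, h4, h5⟩
      refine ⟨z, hz, hQz, fun x hx hzx => h4 ⟨x, hx⟩ hzx, fun i => ?_⟩
      obtain ⟨x, hx, hψ⟩ := h5 i
      exact ⟨x, x.2, hx, hψ⟩
    · rintro ⟨z, hz, hQz, h4, h5⟩
      refine ⟨_, ⟨z, hz, hQz, rfl⟩, fun x hzx => h4 x x.2 hzx, fun i => ?_⟩
      obtain ⟨x, hx, hzx, hψ⟩ := h5 i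
      exact ⟨⟨x, hx⟩, hzx, hψ⟩

theorem CountermodelCoded.not_provable {Q : ℕ → ℕ → ℕ → Prop} {n : ℕ} {φ : Formula α}
    (h : CountermodelCoded Q n φ.code) : ¬ Provable φ := by
  obtain ⟨hf, ht, hφ, u, hu, hn⟩ := h
  intro hp
  exact hn ((hf.sat_model_iff ht φ le_rfl hφ ⟨u, hu⟩).1 (hp.sat hf.model _))

/-- The relation that codes a model on an initial segment of the natural numbers. -/
def Model.coded {n : ℕ} (M : Model α (Fin n)) (a b c : ℕ) : Prop :=
  (∃ (P : Player) (u : Fin n), a = P.idx ∧ b = u ∧ digitSet n c ∈ M.R P u) ∨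
  (∃ (ψ : Formula α) (u : Fin n), a = 2 ∧ b = ψ.code ∧ c = u ∧ M.Sat u ψ) ∨
  (∃ ψ : Formula α, a = 3 ∧ b = ψ.code)

theorem Model.coded_idx {n : ℕ} (M : Model α (Fin n)) (P : Player) (u : Fin n) (z : ℕ) :
    M.coded P.idx u z ↔ digitSet n z ∈ M.R P u := by
  constructor
  · rintro (⟨P', u', h1, h2, h3⟩ | ⟨ψ, u', h1, -⟩ | ⟨ψ, h1, -⟩)
    · obtain rfl : P = P' := by cases P <;> cases P' <;> simp_all [Player.idx]
      rwa [Fin.ext h2]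
    all_goals cases P <;> simp [Player.idx] at h1
  · exact fun h => .inl ⟨P, u, rfl, rfl, h⟩

theorem Model.coded_two {n : ℕ} (M : Model α (Fin n)) (ψ : Formula α) (u : Fin n) :
    M.coded 2 ψ.code u ↔ M.Sat u ψ := by
  constructor
  · rintro (⟨P, u', h1, -⟩ | ⟨ψ', u', -, h1, h2, h3⟩ | ⟨ψ', h1, -⟩)
    · cases P <;> simp [Player.idx] at h1
    · rwa [code_injective h1, Fin.ext h2]
    · simp at h1
  · exact fun h => .inr (.inl ⟨ψ, u, rfl, rfl, rfl, h⟩)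

theorem Model.coded_three {n : ℕ} (M : Model α (Fin n)) (b : ℕ) :
    M.coded 3 b 0 ↔ ∃ ψ : Formula α, ψ.code = b := by
  constructor
  · rintro (⟨P, u', h1, -⟩ | ⟨ψ', u', h1, -⟩ | ⟨ψ', -, h1⟩)
    · cases P <;> simp [Player.idx] at h1
    · simp at h1
    · exact ⟨ψ', h1.symm⟩
  · rintro ⟨ψ, rfl⟩
    exact .inr (.inr ⟨ψ, rfl, rfl⟩)

theorem truthCoded_of_model {n : ℕ} (M : Model α (Fin n)) {Q : ℕ → ℕ → ℕ → Prop}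
    (hR : ∀ (P : Player) (u : Fin n), ∀ z < 2 ^ n, Q P.idx u z ↔ digitSet n z ∈ M.R P u)
    {c : ℕ} (hT : ∀ ψ : Formula α, ψ.code ≤ c → ∀ u : Fin n, Q 2 ψ.code u ↔ M.Sat u ψ)
    (hD : ∀ ψ : Formula α, ψ.code ≤ c → Q 3 ψ.code 0) (ψ : Formula α) (hψ : ψ.code ≤ c) :
    TruthCoded Q n ψ.code := by
  have hT' := hT ψ hψ
  cases ψ with
  | var a => simp [TruthCoded, code]
  | neg φ =>
    have hφ : φ.code ≤ c := (Nat.right_le_pair _ _).trans hψ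
    simp only [code] at hT'
    simp only [TruthCoded, code, Nat.unpair_pair, true_imp_iff]
    refine ⟨⟨hD φ hφ, fun u hu => ?_⟩, by simp, by simp⟩
    rw [hT' ⟨u, hu⟩, hT φ hφ ⟨u, hu⟩, Model.Sat]
  | and φ χ =>
    have hc := (Nat.right_le_pair _ _).trans hψ
    have hφ : φ.code ≤ c := (Nat.left_le_pair _ _).trans hc
    have hχ : χ.code ≤ c := (Nat.right_le_pair _ _).trans hc
    simp only [code] at hT'
    simp only [TruthCoded, code, Nat.unpair_pair, true_imp_iff]
    refine ⟨by simp, ⟨hD φ hφ, hD χ hχ, fun u hu => ?_⟩, by simp⟩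
    rw [hT' ⟨u, hu⟩, hT φ hφ ⟨u, hu⟩, hT χ hχ ⟨u, hu⟩, Model.Sat]
  | box P Ψ φ =>
    rw [code_box] at hψ hT' ⊢
    have hc := (Nat.right_le_pair _ _).trans hψ
    have hφ : φ.code ≤ c := (Nat.right_le_pair _ _).trans hc
    have hΨ : ∀ i, (Ψ i).code ≤ c := fun i =>
      (le_encode_of_mem (List.mem_ofFn.2 ⟨i, rfl⟩)).trans ((Nat.left_le_pair _ _).trans hc)
    simp only [TruthCoded, Nat.unpair_pair, decodeList_encode, Nat.le_add_left, true_imp_iff,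
      List.forall_mem_ofFn_iff, Nat.add_sub_cancel]
    refine ⟨by omega, by omega, fun i => hD _ (hΨ i), hD _ hφ, fun u hu => ?_⟩
    rw [hT' ⟨u, hu⟩, Model.Sat]
    constructor
    · rintro ⟨Z, hZ, h1, h2⟩
      obtain ⟨z, hz, rfl⟩ := exists_digitSet_eq Z
      refine ⟨z, hz, (hR P ⟨u, hu⟩ z hz).2 hZ, fun x hx hzx => ?_, fun i => ?_⟩
      · exact (hT φ hφ ⟨x, hx⟩).2 (h1 _ hzx)
      · obtain ⟨x, hx, hs⟩ := h2 i
        exact ⟨x, x.2, hx, (hT _ (hΨ i) x).2 hs⟩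
    · rintro ⟨z, hz, hQ, h1, h2⟩
      refine ⟨_, (hR P ⟨u, hu⟩ z hz).1 hQ, fun x hx => ?_, fun i => ?_⟩
      · exact (hT φ hφ x).1 (h1 x x.2 hx)
      · obtain ⟨x, hx, hzx, hs⟩ := h2 i
        exact ⟨⟨x, hx⟩, hzx, (hT _ (hΨ i) ⟨x, hx⟩).1 hs⟩

/-- A relation that agrees with the code of a countermodel in a sufficiently large range is a
coded countermodel. -/
theorem countermodelCoded_of_model {n : ℕ} (M : Model α (Fin n)) {φ : Formula α} {w : Fin n}
    (hw : ¬ M.Sat w φ) {N : ℕ} (hn : n ≤ N) (hφ : φ.code ≤ N) {Q : ℕ → ℕ → ℕ → Prop}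
    (hQ : ∀ a ≤ 3, ∀ b ≤ N, ∀ c ≤ 2 ^ N, Q a b c ↔ M.coded a b c) :
    CountermodelCoded Q n φ.code := by
  -- The third argument of `Q` holds a digit set below `2 ^ n`, a world below `n`, or `0`; all of
  -- these are at most `2 ^ N`.
  have hN : N < 2 ^ N := Nat.lt_two_pow_self
  have hR : ∀ (P : Player) (u : Fin n), ∀ z < 2 ^ n,
      Q P.idx u z ↔ digitSet n z ∈ M.R P u := fun P u z hz => by
    rw [← M.coded_idx]
    exact hQ _ (by cases P <;> simp [Player.idx]) _ (by omega) _
      (hz.le.trans (Nat.pow_le_pow_right two_pos hn))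
  have hT : ∀ ψ : Formula α, ψ.code ≤ φ.code → ∀ u : Fin n, Q 2 ψ.code u ↔ M.Sat u ψ :=
    fun ψ hψ u => by
      rw [← M.coded_two]
      exact hQ _ (by omega) _ (by omega) _ (by omega)
  have hD : ∀ b ≤ φ.code, Q 3 b 0 ↔ ∃ ψ : Formula α, ψ.code = b := fun b hb => by
    rw [← M.coded_three]
    exact hQ _ (by omega) _ (by omega) _ (by omega)
  refine ⟨frameCoded_of_model M hR, fun b hb hQb => ?_, (hD _ le_rfl).2 ⟨φ, rfl⟩, w, w.2, ?_⟩
  · obtain ⟨ψ, rfl⟩ := (hD b (by omega)).1 hQb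
    exact truthCoded_of_model M hR hT (fun ψ hψ => (hD _ hψ).2 ⟨ψ, rfl⟩) ψ (by omega)
  · rwa [hT φ le_rfl w]

end Decoding

/-! ### The decision procedure -/

/-- The ternary relation given by the binary digits of `m`. -/
def digitRel (m a b c : ℕ) : Prop := m.testBit (Nat.pair a (Nat.pair b c)) = true

theorem pair_lt_pair_of_lt_of_le {a b c d : ℕ} (h : a < c) (h' : b ≤ d) :
    Nat.pair a b < Nat.pair c d :=
  (Nat.pair_lt_pair_left b h).trans_le
    (h'.eq_or_lt.elim (fun h => h ▸ le_rfl) fun h => (Nat.pair_lt_pair_right c h).le)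

/-- Reduces a search over relations on a finite box to a search over numbers below an explicit
bound. By monotonicity of pairing every index from the box is below the exponent; the two `+ 1` make
this strict. -/
theorem exists_digitRel_iff (Q : ℕ → ℕ → ℕ → Prop) (A B C : ℕ) :
    ∃ m < 2 ^ Nat.pair (A + 1) (Nat.pair (B + 1) C), ∀ a ≤ A, ∀ b ≤ B, ∀ c ≤ C,
      digitRel m a b c ↔ Q a b c := by
  classical
  refine ⟨Nat.ofBits fun i => decide (Q (Nat.unpair i).1 (Nat.unpair (Nat.unpair i).2).1
    (Nat.unpair (Nat.unpair i).2).2), Nat.ofBits_lt_two_pow _, fun a ha b hb c hc => ?_⟩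
  rw [digitRel, Nat.testBit_ofBits_lt]
  · simp
  · exact pair_lt_pair_of_lt_of_le (by omega) (pair_lt_pair_of_lt_of_le (by omega) hc).le

/-- The formula with code `c` has a countermodel within the bounds of the finite model property. -/
def Refutable (c : ℕ) : Prop :=
  -- There are at most `2 ^ size ≤ 2 ^ (c + 1)` worlds. The coded relation is needed for tags up to
  -- `3`, worlds and formula codes up to `2 ^ (c + 1)`, and digit sets up to `2 ^ 2 ^ (c + 1)`.
  ∃ n < 2 ^ (c + 1) + 1,
    ∃ m < 2 ^ Nat.pair (3 + 1) (Nat.pair (2 ^ (c + 1) + 1) (2 ^ 2 ^ (c + 1))),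
      CountermodelCoded (digitRel m) n c

theorem refutable_code_iff [Encodable α] (φ : Formula α) : Refutable φ.code ↔ ¬ Provable φ := by
  constructor
  · rintro ⟨n, -, m, -, h⟩
    exact h.not_provable
  · intro h
    obtain ⟨n, hn, M, w, hw⟩ := exists_model_of_not_provable h
    have hn' : n ≤ 2 ^ (φ.code + 1) :=
      hn.trans (Nat.pow_le_pow_right two_pos φ.size_le_code)
    have hc : φ.code + 1 < 2 ^ (φ.code + 1) := Nat.lt_two_pow_self
    obtain ⟨m, hm, hQ⟩ :=
      exists_digitRel_iff M.coded 3 (2 ^ (φ.code + 1)) (2 ^ 2 ^ (φ.code + 1))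
    exact ⟨n, by omega, m, hm, countermodelCoded_of_model M hw hn' (by omega) hQ⟩

/-! ### Primitive recursiveness of the search -/

section Primrec

open Primrec

variable {β : Type*} [Primcodable β]

theorem primrecPred_exists_lt {p : β → ℕ → Prop} {b : β → ℕ}
    (hp : PrimrecPred fun x : β × ℕ => p x.1 x.2) (hb : Primrec b) :
    PrimrecPred fun a => ∃ x < b a, p a x := by
  have h : PrimrecRel fun (x : ℕ) (a : β) => p a x := hp.comp (Primrec.snd.pair Primrec.fst)
  exact (h.exists_mem_list.comp (list_range.comp hb) Primrec.id).of_eq (by simp)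

theorem primrecPred_forall_mem {p : β → ℕ → Prop} {l : β → List ℕ}
    (hp : PrimrecPred fun x : β × ℕ => p x.1 x.2) (hl : Primrec l) :
    PrimrecPred fun a => ∀ x ∈ l a, p a x := by
  have h : PrimrecRel fun (x : ℕ) (a : β) => p a x := hp.comp (Primrec.snd.pair Primrec.fst)
  exact h.forall_mem_list.comp hl Primrec.id

theorem primrecPred_forall_lt {p : β → ℕ → Prop} {b : β → ℕ}
    (hp : PrimrecPred fun x : β × ℕ => p x.1 x.2) (hb : Primrec b) :
    PrimrecPred fun a => ∀ x < b a, p a x :=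
  (primrecPred_forall_mem hp (list_range.comp hb)).of_eq (by simp)

theorem primrecPred_imp {p q : β → Prop} (hp : PrimrecPred p) (hq : PrimrecPred q) :
    PrimrecPred fun a => p a → q a :=
  (hp.not.or hq).of_eq fun _ => imp_iff_not_or.symm

theorem primrecPred_iff {p q : β → Prop} (hp : PrimrecPred p) (hq : PrimrecPred q) :
    PrimrecPred fun a => p a ↔ q a :=
  ((primrecPred_imp hp hq).and (primrecPred_imp hq hp)).of_eq fun _ =>
    iff_iff_implies_and_implies.symm

theorem primrec_two_pow {f : β → ℕ} (hf : Primrec f) : Primrec fun a => 2 ^ f a :=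
  (Primrec₂.unpaired'.1 Nat.Primrec.pow).comp (.const 2) hf

theorem primrec_natPair {f g : β → ℕ} (hf : Primrec f) (hg : Primrec g) :
    Primrec fun a => Nat.pair (f a) (g a) :=
  Primrec₂.natPair.comp hf hg

theorem primrec_unpair_fst {f : β → ℕ} (hf : Primrec f) : Primrec fun a => (f a).unpair.1 :=
  Primrec.fst.comp (Primrec.unpair.comp hf)

theorem primrec_unpair_snd {f : β → ℕ} (hf : Primrec f) : Primrec fun a => (f a).unpair.2 :=
  Primrec.snd.comp (Primrec.unpair.comp hf)

theorem primrec_decodeList {f : β → ℕ} (hf : Primrec f) : Primrec fun a => decodeList (f a) :=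
  option_getD.comp (Primrec.decode.comp hf) (.const [])

theorem primrecPred_testBit {f g : β → ℕ} (hf : Primrec f) (hg : Primrec g) :
    PrimrecPred fun a => (f a).testBit (g a) = true :=
  (Primrec.eq.comp (nat_mod.comp (nat_div.comp hf (primrec_two_pow hg)) (.const 2))
    (.const 1)).of_eq fun a => by simp [Nat.testBit_eq_decide_div_mod_eq]

theorem primrecPred_digitRel {m f g h : β → ℕ} (hm : Primrec m) (hf : Primrec f)
    (hg : Primrec g) (hh : Primrec h) : PrimrecPred fun a => digitRel (m a) (f a) (g a) (h a) :=
  primrecPred_testBit hm (primrec_natPair hf (primrec_natPair hg hh))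

/-- All quantifiers are bounded by `n` or `2 ^ n`, so the condition is primitive recursive in the
two numbers `m` and `n`. -/
theorem primrecPred_frameCoded {m n : β → ℕ} (hm : Primrec m) (hn : Primrec n) :
    PrimrecPred fun a => FrameCoded (digitRel (m a)) (n a) := by
  have key : PrimrecPred fun a : ℕ × ℕ => FrameCoded (digitRel a.1) a.2 := by
    unfold FrameCoded
    with_reducible repeat' first
      | exact Primrec.fst | exact Primrec.snd | exact Primrec.const _
      | apply PrimrecPred.and | apply primrecPred_exists_lt | apply primrecPred_forall_lt
      | apply primrecPred_imp | apply primrecPred_digitRel | apply primrecPred_testBit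
      | apply primrec_two_pow | refine Primrec.nat_sub.comp ?_ ?_
      | apply Primrec.fst.comp | apply Primrec.snd.comp
  exact key.comp (hm.pair hn)

theorem primrecPred_truthCoded {m n b : β → ℕ} (hm : Primrec m) (hn : Primrec n)
    (hb : Primrec b) : PrimrecPred fun a => TruthCoded (digitRel (m a)) (n a) (b a) := by
  have key : PrimrecPred fun a : ℕ × ℕ × ℕ => TruthCoded (digitRel a.1) a.2.1 a.2.2 := by
    unfold TruthCoded
    with_reducible repeat' first
      | exact Primrec.fst | exact Primrec.snd | exact Primrec.const _
      | apply PrimrecPred.not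
      | apply PrimrecPred.and | apply primrecPred_exists_lt | apply primrecPred_forall_lt
      | apply primrecPred_forall_mem | apply primrecPred_imp | apply primrecPred_iff
      | apply primrecPred_digitRel | apply primrecPred_testBit
      | refine Primrec.eq.comp ?_ ?_ | refine Primrec.nat_le.comp ?_ ?_
      | apply primrec_two_pow | refine Primrec.nat_sub.comp ?_ ?_
      | apply primrec_decodeList | apply primrec_unpair_fst | apply primrec_unpair_snd
      | apply Primrec.fst.comp | apply Primrec.snd.comp
  exact key.comp (hm.pair (hn.pair hb))

theorem primrecPred_refutable : PrimrecPred Refutable := by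
  unfold Refutable CountermodelCoded
  have hid : Primrec fun c : ℕ => c := Primrec.id
  with_reducible repeat' first
    | exact hid | exact Primrec.fst | exact Primrec.snd | exact Primrec.const _
    | apply primrecPred_frameCoded | apply primrecPred_truthCoded
    | apply PrimrecPred.not
    | apply PrimrecPred.and | apply primrecPred_exists_lt | apply primrecPred_forall_lt
    | apply primrecPred_imp | apply primrecPred_digitRel
    | apply primrec_natPair | apply primrec_two_pow | refine Primrec.nat_add.comp ?_ ?_
    | apply Primrec.fst.comp | apply Primrec.snd.comp

end Primrec

/-- Provability is decidable. -/
theorem decidableSet_provable [Encodable α] :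
    DecidableSet {φ : Formula α | Provable φ} := by
  obtain ⟨_, h⟩ := primrecPred_refutable
  refine ⟨fun c => !decide (Refutable c), (Primrec.not.comp h).to_comp, fun φ => ?_⟩
  simp [refutable_code_iff]

end InstantialGame

theorem mainTheorem3 {α : Type*} [Encodable α] :
    InstantialGame.DecidableSet {φ : InstantialGame.Formula α | InstantialGame.Provable φ} ∧
    (∃ f : ℕ → ℕ, Computable f ∧ ∀ φ : InstantialGame.Formula α,
      (InstantialGame.Provable φ →
        ∀ (W : Type*) (M : InstantialGame.Model α W) (w : W), M.Sat w φ) ∧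
      (¬ InstantialGame.Provable φ →
        ∃ n ≤ f φ.size, ∃ (M : InstantialGame.Model α (Fin n)) (w : Fin n), ¬ M.Sat w φ)) :=
  ⟨InstantialGame.decidableSet_provable, fun k => 2 ^ k,
    (InstantialGame.primrec_two_pow .id).to_comp, fun _ =>
      ⟨fun h _ M w => h.sat M w, InstantialGame.exists_model_of_not_provable⟩⟩
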